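/- For integers $A,B$ let $v_n(A,B)$ be the Lucas sequence given by $v_0(A,B)=2$, $v_1(A,B)=A$ and $v_{n+1}(A,B)=A\,v_n(A,B)-B\,v_{n-1}(A,B)$ for $n\ge 1$. Let $L_n$ be the Lucas numbers ($L_0=2$, $L_1=1$, $L_{n+2}=L_{n+1}+L_n$), let $H_n=\sum_{k=1}^n \frac1k$ be the harmonic numbers (with $H_0=0$), let $\zeta$ be the Riemann zeta function, and let $\phi=\frac{1+\sqrt5}{2}$. Then $v_n(3,1)=L_{2n}$ for all $n\ge 0$, and the following four series converge, with \begin{align*} \sum_{n=1}^\infty \frac{L_{2n}}{n^2\binom{2n}{n}}\left(H_{2n}-H_{n-1}\right)&=\frac{41\zeta(3)+4\pi^2\log\phi}{25},\\ \sum_{n=1}^\infty \frac{v_n(5,5)}{n^2\binom{2n}{n}}\left(H_{2n}-H_{n-1}\right)&=\frac{124\zeta(3)+\pi^2\log\left(5^5\phi^6\right)}{50},\\ \sum_{n=1}^\infty \frac{v_n(4,1)}{n^2\binom{2n}{n}}\left(H_{2n}-H_{n-1}\right)&=\frac{23\zeta(3)+2\pi^2\log(2+\sqrt{3})}{12},\\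 \sum_{n=1}^\infty \frac{v_n(4,2)}{n^2\binom{2n}{n}}\left(H_{2n}-H_{n-1}\right)&=\frac{259\zeta(3)+2\pi^2\left(5\log 2+8\log(1+\sqrt{2})\right)}{128}. \end{align*} -/

import Mathlib

/-- The Lucas sequence `v_n(A, B)`: `v_0 = 2`, `v_1 = A`, `v_{n+2} = A v_{n+1} - B v_n`. -/
def lucasV (A B : ℤ) : ℕ → ℤ
  | 0 => 2
  | 1 => A
  | n + 2 => A * lucasV A B (n + 1) - B * lucasV A B n

/-- The classical Lucas numbers `2, 1, 3, 4, 7, 11, …`. -/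
def lucasNumber : ℕ → ℤ
  | 0 => 2
  | 1 => 1
  | n + 2 => lucasNumber (n + 1) + lucasNumber n

/-- The `n`-th term (used for `n ≥ 1` only) `a_n (H_{2n} - H_{n-1}) / (n² binom(2n, n))`
of the series attached to an integer sequence `a`. It is a real number, viewed in `ℂ`
because Mathlib's `riemannZeta` is complex-valued. -/
noncomputable def sunTerm (a : ℕ → ℤ) (n : ℕ) : ℂ :=
  (a n : ℂ) / ((n : ℂ) ^ 2 * ((2 * n).choose n : ℂ)) *
    (((harmonic (2 * n) : ℚ) : ℂ) - ((harmonic (n - 1) : ℚ) : ℂ))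

/-! Write `c n` for the coefficient `(H_{2n} - H_{n-1}) / (n² binom(2n, n))` and `F(x) = ∑ c n xⁿ`,
a power series controlled for `|x| < 4`. Since `v_n(A, B) = xⁿ + yⁿ` for the roots `x, y` of `t² - A
t + B`, each series equals `F(x) + F(y)`. In all four cases the roots have the form `4 sin² θ` with
`θ` a rational multiple of `π`.

The key is the closed form `powSum_sunCoeff_sin`: `F(4 sin² θ) = Cl(0) - Cl(2θ) + 2θ² log(2 sin θ)`,
with `Cl(t) = ∑ cos(nt) / n³` and `0 < θ < π/2`. Under `x = 4 sin² θ` the coefficient recurrences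
say that `B(x) = ∑ xⁿ / (n² binom(2n, n))` has second `θ`-derivative 4, so `B = 2θ²`, and that the
second `θ`-derivative of `F` is an explicit expression in `B` and `B'`. The right side has the same
second derivative, because `Cl'' = log(2 sin(t/2))`, and both sides vanish to first order at `θ =
0`.

It remains to evaluate `Cl(2θ) + Cl(2η)` for the two angles. The distribution relation `∑ Cl(t +
2πk/m) = Cl(mt) / m²` and the symmetry `t ↦ 2π - t` make it a rational multiple of `Cl(0) = ζ(3)`.
-/

open Filter Topology

/-! ### Power series with coefficients of size about `4⁻ⁿ` -/

/-- The sum of the real power series with coefficients `c`. -/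
noncomputable def powSum (c : ℕ → ℝ) (x : ℝ) : ℝ := ∑' n, c n * x ^ n

/-- The coefficients of the Euler derivative `x d/dx` of a power series. -/
def eulerCoeff (c : ℕ → ℝ) (n : ℕ) : ℝ := n * c n

/-- The coefficients `c n` are bounded by a polynomial multiple of `4⁻ⁿ`. -/
def QuarterGrowth (c : ℕ → ℝ) : Prop := ∃ (C : ℝ) (k : ℕ), ∀ n, |c n| * 4 ^ n ≤ C * n ^ k

theorem QuarterGrowth.eulerCoeff {c : ℕ → ℝ} (hc : QuarterGrowth c) :
    QuarterGrowth (eulerCoeff c) := by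
  obtain ⟨C, k, h⟩ := hc
  refine ⟨C, k + 1, fun n => ?_⟩
  have := mul_le_mul_of_nonneg_left (h n) n.cast_nonneg (α := ℝ)
  rw [_root_.eulerCoeff, abs_mul, Nat.abs_cast, pow_succ]
  linarith

theorem QuarterGrowth.summable_abs {c : ℕ → ℝ} (hc : QuarterGrowth c) {r : ℝ} (hr : 0 ≤ r)
    (hr4 : r < 4) : Summable fun n => |c n| * r ^ n := by
  obtain ⟨C, k, h⟩ := hc
  have hs : Summable fun n : ℕ => (n : ℝ) ^ k * (r / 4) ^ n := by
    apply summable_pow_mul_geometric_of_norm_lt_one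
    rw [Real.norm_of_nonneg (by positivity)]
    linarith
  refine Summable.of_nonneg_of_le (fun n => by positivity) (fun n => ?_) (hs.mul_left C)
  have := mul_le_mul_of_nonneg_right (h n) (by positivity : 0 ≤ (r / 4) ^ n)
  calc |c n| * r ^ n = |c n| * 4 ^ n * (r / 4) ^ n := by
        rw [mul_assoc, ← mul_pow, mul_div_cancel₀ r (by norm_num)]
    _ ≤ _ := by rw [← mul_assoc]; exact this

theorem QuarterGrowth.summable {c : ℕ → ℝ} (hc : QuarterGrowth c) {x : ℝ} (hx : |x| < 4) :
    Summable fun n => c n * x ^ n := by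
  refine Summable.of_abs ?_
  simpa [abs_mul, abs_pow] using hc.summable_abs (abs_nonneg x) hx

theorem QuarterGrowth.exists_hasDerivAt_powSum {c : ℕ → ℝ} (hc : QuarterGrowth c) {x : ℝ}
    (hx : |x| < 4) : ∃ y, HasDerivAt (powSum c) y x ∧ x * y = powSum (_root_.eulerCoeff c) x := by
  obtain ⟨r, hxr, hr4⟩ := exists_between hx
  have hr : 0 < r := (abs_nonneg x).trans_lt hxr
  refine ⟨∑' n, c n * (n * x ^ (n - 1)), ?_, ?_⟩
  -- An intermediate radius `|x| < r < 4` gives a summable bound for the differentiated terms,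
  -- uniform on `(-r, r)`.
  · have hu : Summable fun n => |c n| * (n * r ^ (n - 1)) := by
      refine ((hc.eulerCoeff.summable_abs hr.le hr4).div_const r).congr fun n => ?_
      rw [_root_.eulerCoeff, abs_mul, Nat.abs_cast]
      rcases n with _ | n
      · simp
      · rw [Nat.add_sub_cancel, pow_succ]
        field_simp
    refine hasDerivAt_tsum_of_isPreconnected (t := Set.Ioo (-r) r) (y₀ := 0) hu isOpen_Ioo
      isPreconnected_Ioo (fun n y _ => (hasDerivAt_pow n y).const_mul (c n)) (fun n y hy => ?_)
      ⟨by linarith, hr⟩ (hc.summable (by simp)) (abs_lt.1 hxr)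
    rw [Real.norm_eq_abs, abs_mul, abs_mul, abs_pow, Nat.abs_cast]
    have := (abs_lt.2 hy).le
    gcongr
  · rw [← tsum_mul_left]
    refine tsum_congr fun n => ?_
    rw [_root_.eulerCoeff]
    rcases n with _ | n
    · simp
    · rw [Nat.add_sub_cancel, pow_succ]
      ring

/-- The linear rate, not just continuity at 0, is what later beats the pole of `cot θ`. -/
theorem abs_powSum_le {c : ℕ → ℝ} (hc : QuarterGrowth c) (h0 : c 0 = 0) {x : ℝ} (hx : 0 ≤ x)
    (hx1 : x ≤ 1) : |powSum c x| ≤ (∑' n, |c n|) * x := by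
  have hs : Summable fun n => |c n| := by simpa using hc.summable_abs zero_le_one (by norm_num)
  rw [powSum, ← tsum_mul_right, ← Real.norm_eq_abs]
  refine tsum_of_norm_bounded (hs.mul_right x).hasSum fun n => ?_
  rw [Real.norm_eq_abs, abs_mul, abs_pow, abs_of_nonneg hx]
  rcases n with _ | n
  · simp [h0]
  · have : x ^ (n + 1) ≤ x := pow_le_of_le_one hx hx1 (by simp)
    gcongr

/-! ### The substitution `x = 4 sin² θ` -/

theorem four_mul_sin_sq_lt {θ : ℝ} (h : θ ∈ Set.Ioo 0 (Real.pi / 2)) :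
    |4 * Real.sin θ ^ 2| < 4 := by
  have := Real.cos_pos_of_mem_Ioo (x := θ) ⟨by linarith [h.1, h.2], h.2⟩
  rw [abs_of_nonneg (by positivity)]
  nlinarith [Real.sin_sq_add_cos_sq θ]

theorem hasDerivAt_powSum_sin {c : ℕ → ℝ} (hc : QuarterGrowth c) {θ : ℝ}
    (h : θ ∈ Set.Ioo 0 (Real.pi / 2)) :
    HasDerivAt (fun t => powSum c (4 * Real.sin t ^ 2))
      (2 * (Real.cos θ / Real.sin θ) * powSum (eulerCoeff c) (4 * Real.sin θ ^ 2)) θ := by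
  have hs := Real.sin_pos_of_pos_of_lt_pi h.1 (by linarith [h.2, Real.pi_pos])
  obtain ⟨y, hy, hxy⟩ := hc.exists_hasDerivAt_powSum (four_mul_sin_sq_lt h)
  have := HasDerivAt.comp θ hy (((Real.hasDerivAt_sin θ).pow 2).const_mul 4)
  refine this.congr_deriv ?_
  rw [← hxy]
  push_cast
  field_simp

/-- With `D = x d/dx` one has `d/dθ = 2 cot θ · D`. Its square is `(16 D² - 8 D - 4x D²) / x`, the
operator encoded by the recurrence `invSqCentral_succ`. -/
theorem hasDerivAt_deriv_powSum_sin {c : ℕ → ℝ} (hc : QuarterGrowth c) {θ : ℝ}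
    (h : θ ∈ Set.Ioo 0 (Real.pi / 2)) :
    HasDerivAt (fun t => 2 * (Real.cos t / Real.sin t) *
        powSum (eulerCoeff c) (4 * Real.sin t ^ 2))
      ((16 * powSum (eulerCoeff (eulerCoeff c)) (4 * Real.sin θ ^ 2)
        - 8 * powSum (eulerCoeff c) (4 * Real.sin θ ^ 2)
        - 4 * (4 * Real.sin θ ^ 2) * powSum (eulerCoeff (eulerCoeff c)) (4 * Real.sin θ ^ 2))
        / (4 * Real.sin θ ^ 2)) θ := by
  have hs := Real.sin_pos_of_pos_of_lt_pi h.1 (by linarith [h.2, Real.pi_pos])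
  have h1 := (((Real.hasDerivAt_cos θ).div (Real.hasDerivAt_sin θ) hs.ne').const_mul 2).mul
    (hasDerivAt_powSum_sin hc.eulerCoeff h)
  refine h1.congr_deriv ?_
  have : Real.cos θ ^ 2 = 1 - Real.sin θ ^ 2 := Real.cos_sq' θ
  simp only [Pi.div_apply]
  field_simp
  ring_nf
  rw [this]
  ring

theorem tendsto_powSum_sin_zero {c : ℕ → ℝ} (hc : QuarterGrowth c) (h0 : c 0 = 0) :
    Tendsto (fun t => powSum c (4 * Real.sin t ^ 2)) (𝓝[>] 0) (𝓝 0) := by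
  have hx : Tendsto (fun t => 4 * Real.sin t ^ 2) (𝓝[>] 0) (𝓝 0) := by
    have : ContinuousAt (fun t => 4 * Real.sin t ^ 2) 0 := by fun_prop
    simpa [ContinuousAt] using this.tendsto.mono_left nhdsWithin_le_nhds
  refine squeeze_zero_norm' ?_ (by simpa using hx.const_mul (∑' n, |c n|))
  filter_upwards [hx.eventually_le_const zero_lt_one] with t ht
  exact abs_powSum_le hc h0 (by positivity) ht

theorem tendsto_deriv_powSum_sin_zero {c : ℕ → ℝ} (hc : QuarterGrowth c) :
    Tendsto (fun t => 2 * (Real.cos t / Real.sin t) *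
      powSum (eulerCoeff c) (4 * Real.sin t ^ 2)) (𝓝[>] 0) (𝓝 0) := by
  have hx : Tendsto (fun t => 4 * Real.sin t ^ 2) (𝓝[>] 0) (𝓝 0) := by
    have : ContinuousAt (fun t => 4 * Real.sin t ^ 2) 0 := by fun_prop
    simpa [ContinuousAt] using this.tendsto.mono_left nhdsWithin_le_nhds
  have hy : Tendsto (fun t => (∑' n, |eulerCoeff c n|) * (8 * |Real.sin t|)) (𝓝[>] 0) (𝓝 0) := by
    have : ContinuousAt (fun t => (∑' n, |eulerCoeff c n|) * (8 * |Real.sin t|)) 0 := by fun_prop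
    simpa [ContinuousAt] using this.tendsto.mono_left nhdsWithin_le_nhds
  refine squeeze_zero_norm' ?_ hy
  filter_upwards [hx.eventually_le_const zero_lt_one] with t ht
  have h1 := abs_powSum_le hc.eulerCoeff (by simp [eulerCoeff]) (by positivity) ht
  rw [Real.norm_eq_abs, abs_mul, abs_mul, abs_two, abs_div]
  rcases eq_or_ne (Real.sin t) 0 with h | h
  · simp [h]
  have h2 := abs_pos.2 h
  calc 2 * (|Real.cos t| / |Real.sin t|) * |powSum (eulerCoeff c) (4 * Real.sin t ^ 2)|
      ≤ 2 * (1 / |Real.sin t|) * ((∑' n, |eulerCoeff c n|) * (4 * Real.sin t ^ 2)) := by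
        gcongr
        exact Real.abs_cos_le_one t
    _ = _ := by
        rw [← sq_abs (Real.sin t)]
        field_simp
        ring

/-! ### Uniqueness from second derivatives -/

theorem eq_zero_of_hasDerivAt_zero {f : ℝ → ℝ} {b : ℝ}
    (hf : ∀ t ∈ Set.Ioo 0 b, HasDerivAt f 0 t) (h0 : Tendsto f (𝓝[>] 0) (𝓝 0)) :
    ∀ t ∈ Set.Ioo 0 b, f t = 0 := by
  intro t ht
  have hb : 0 < b := ht.1.trans ht.2
  have hc : ∀ u ∈ Set.Ioo 0 b, f u = f t := fun u hu =>
    isOpen_Ioo.is_const_of_deriv_eq_zero isPreconnected_Ioo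
      (fun v hv => (hf v hv).differentiableAt.differentiableWithinAt)
      (fun v hv => (hf v hv).deriv) hu ht
  refine tendsto_nhds_unique (f := fun _ : ℝ => f t) tendsto_const_nhds (h0.congr' ?_)
  filter_upwards [Ioo_mem_nhdsGT hb] with u hu using hc u hu

/-- Initial data enter as right limits at 0, since the functions to be compared contain `cot` and
`log sin`, which are singular there. -/
theorem eq_of_second_deriv_eq {f f' g g' d : ℝ → ℝ} {b : ℝ}
    (hf : ∀ t ∈ Set.Ioo 0 b, HasDerivAt f (f' t) t)
    (hf' : ∀ t ∈ Set.Ioo 0 b, HasDerivAt f' (d t) t)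
    (hg : ∀ t ∈ Set.Ioo 0 b, HasDerivAt g (g' t) t)
    (hg' : ∀ t ∈ Set.Ioo 0 b, HasDerivAt g' (d t) t)
    (f0 : Tendsto f (𝓝[>] 0) (𝓝 0)) (f0' : Tendsto f' (𝓝[>] 0) (𝓝 0))
    (g0 : Tendsto g (𝓝[>] 0) (𝓝 0)) (g0' : Tendsto g' (𝓝[>] 0) (𝓝 0)) :
    ∀ t ∈ Set.Ioo 0 b, f t = g t ∧ f' t = g' t := by
  have h1 : ∀ t ∈ Set.Ioo 0 b, f' t - g' t = 0 :=
    eq_zero_of_hasDerivAt_zero (fun t ht => by simpa using! (hf' t ht).sub (hg' t ht))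
      (by simpa using f0'.sub g0')
  have h2 : ∀ t ∈ Set.Ioo 0 b, f t - g t = 0 :=
    eq_zero_of_hasDerivAt_zero (fun t ht => by
      have := (hf t ht).sub (hg t ht)
      rw [h1 t ht] at this
      exact this) (by simpa using f0.sub g0)
  exact fun t ht => ⟨sub_eq_zero.1 (h2 t ht), sub_eq_zero.1 (h1 t ht)⟩

/-! ### The coefficients: recurrences and growth -/

/-- The reciprocal `1 / (n² binom(2n, n))`, which is `0` for `n = 0`. -/
noncomputable def invSqCentral (n : ℕ) : ℝ := 1 / ((n : ℝ) ^ 2 * ((2 * n).choose n : ℝ))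

/-- The difference `H_{2n} - H_{n-1}` of harmonic numbers. -/
noncomputable def harmonicGap (n : ℕ) : ℝ := (harmonic (2 * n) : ℝ) - (harmonic (n - 1) : ℝ)

/-- The coefficient `(H_{2n} - H_{n-1}) / (n² binom(2n, n))`. -/
noncomputable def sunCoeff (n : ℕ) : ℝ := invSqCentral n * harmonicGap n

theorem invSqCentral_zero : invSqCentral 0 = 0 := by simp [invSqCentral]

theorem invSqCentral_succ {n : ℕ} (hn : n ≠ 0) :
    (16 * ((n : ℝ) + 1) ^ 2 - 8 * (n + 1)) * invSqCentral (n + 1)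
      = 4 * (n : ℝ) ^ 2 * invSqCentral n := by
  have h : ((n : ℝ) + 1) * (n + 1).centralBinom = 2 * (2 * n + 1) * n.centralBinom := by
    exact_mod_cast n.succ_mul_centralBinom_succ
  have hn' : (n : ℝ) ≠ 0 := by exact_mod_cast hn
  have h0 : (n.centralBinom : ℝ) ≠ 0 := by exact_mod_cast n.centralBinom_ne_zero
  have h1 : ((n + 1).centralBinom : ℝ) ≠ 0 := by exact_mod_cast (n + 1).centralBinom_ne_zero
  have h2 : (n : ℝ) + 1 ≠ 0 := by positivity
  rw [invSqCentral, invSqCentral, ← Nat.centralBinom_eq_two_mul_choose,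
    ← Nat.centralBinom_eq_two_mul_choose]
  push_cast
  field_simp
  linear_combination -4 * h

/-- The increment is half the logarithmic derivative of the ratio in `invSqCentral_succ`: `1/(2n+1)
+ 1/(2(n+1))` comes from `16(n+1)² - 8(n+1)` and `1/n` from `4n²`. For `n = 0` the truncated `n - 1`
would break the formula. -/
theorem harmonicGap_succ {n : ℕ} (hn : n ≠ 0) :
    harmonicGap (n + 1) = harmonicGap n + 1 / (2 * n + 1) + 1 / (2 * (n + 1)) - 1 / n := by
  obtain ⟨m, rfl⟩ := Nat.exists_eq_succ_of_ne_zero hn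
  rw [harmonicGap, harmonicGap, Nat.succ_eq_add_one,
    show 2 * (m + 1 + 1) = 2 * (m + 1) + 1 + 1 by ring,
    harmonic_succ (2 * (m + 1) + 1), harmonic_succ (2 * (m + 1)), Nat.add_sub_cancel,
    Nat.add_sub_cancel, harmonic_succ m]
  push_cast
  field_simp
  ring

theorem harmonicGap_nonneg (n : ℕ) : 0 ≤ harmonicGap n := by
  rw [harmonicGap, sub_nonneg]
  refine Rat.cast_le.2 ?_
  rw [harmonic, harmonic]
  exact Finset.sum_le_sum_of_subset_of_nonneg (Finset.range_mono (by lia))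
    fun i _ _ => by positivity

/-- From `n = 1` on the gap does not increase, and its value there is `H_2 - H_0 = 3/2`. -/
theorem harmonicGap_le (n : ℕ) : harmonicGap n ≤ 3 / 2 := by
  induction n with
  | zero => norm_num [harmonicGap]
  | succ n ih =>
    rcases eq_or_ne n 0 with rfl | hn
    · norm_num [harmonicGap, harmonic, Finset.sum_range_succ]
    · rw [harmonicGap_succ hn]
      have hn' : (0 : ℝ) < n := by positivity
      have : 1 / (2 * (n : ℝ) + 1) + 1 / (2 * (n + 1)) ≤ 1 / (2 * n) + 1 / (2 * n) := by
        gcongr <;> linarith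
      have h2 : 1 / (2 * (n : ℝ)) + 1 / (2 * n) = 1 / n := by
        field_simp
        norm_num
      linarith

theorem quarterGrowth_invSqCentral : QuarterGrowth invSqCentral := by
  -- From `4ⁿ ≤ 2n binom(2n, n)` the product is at most `2/n ≤ 2`.
  refine ⟨2, 0, fun n => ?_⟩
  rcases eq_or_ne n 0 with rfl | hn
  · simp [invSqCentral]
  have h := n.four_pow_le_two_mul_self_mul_centralBinom (Nat.pos_of_ne_zero hn)
  have h' : (4 : ℝ) ^ n ≤ 2 * n * n.centralBinom := by exact_mod_cast h
  have hn1 : (1 : ℝ) ≤ n := by exact_mod_cast Nat.one_le_iff_ne_zero.2 hn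
  have h0 : (0 : ℝ) < n.centralBinom := by exact_mod_cast n.centralBinom_pos
  rw [invSqCentral, ← Nat.centralBinom_eq_two_mul_choose, abs_of_nonneg (by positivity), pow_zero,
    mul_one, one_div_mul_eq_div, div_le_iff₀ (by positivity)]
  nlinarith [mul_le_mul_of_nonneg_right hn1 (by positivity : 0 ≤ n * (n.centralBinom : ℝ))]

theorem quarterGrowth_sunCoeff : QuarterGrowth sunCoeff := by
  obtain ⟨C, k, h⟩ := quarterGrowth_invSqCentral
  refine ⟨C * (3 / 2), k, fun n => ?_⟩
  rw [sunCoeff, abs_mul, abs_of_nonneg (harmonicGap_nonneg n)]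
  calc _ = |invSqCentral n| * 4 ^ n * harmonicGap n := by ring
    _ ≤ C * n ^ k * (3 / 2) :=
      mul_le_mul (h n) (harmonicGap_le n) (harmonicGap_nonneg n)
        ((by positivity : 0 ≤ |invSqCentral n| * 4 ^ n).trans (h n))
    _ = _ := by ring

theorem QuarterGrowth.hasSum {c : ℕ → ℝ} (hc : QuarterGrowth c) {x : ℝ} (hx : |x| < 4) :
    HasSum (fun n => c n * x ^ n) (powSum c x) := (hc.summable hx).hasSum

/-! ### Differential equations for the two generating series -/

/-- Turns a first-order coefficient recurrence into a functional equation; `δ` is its defect at the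
step from 0 to 1, where dividing by `n` is meaningless. -/
theorem eq_of_hasSum_shift {a e : ℕ → ℝ} {x A B δ : ℝ} (ha : HasSum (fun n => a n * x ^ n) A)
    (he : HasSum (fun n => e n * x ^ n) B) (h0 : a 0 = 0) (h1 : a 1 = e 0 + δ)
    (h : ∀ n, n ≠ 0 → a (n + 1) = e n) : A = x * B + δ * x := by
  have h2 : HasSum (fun n => a (n + 1) * x ^ (n + 1)) A := by
    simpa [h0] using (hasSum_nat_add_iff' 1).2 ha
  have h3 := (he.mul_left x).add (hasSum_ite_eq 0 (δ * x))
  refine h2.unique (h3.congr_fun fun n => ?_)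
  rcases eq_or_ne n 0 with rfl | hn
  · simp [h1]
    ring
  · rw [h n hn, if_neg hn, pow_succ]
    ring

theorem powSum_invSqCentral_ode {x : ℝ} (hx : |x| < 4) :
    16 * powSum (eulerCoeff (eulerCoeff invSqCentral)) x
      - 8 * powSum (eulerCoeff invSqCentral) x
      - 4 * x * powSum (eulerCoeff (eulerCoeff invSqCentral)) x = 4 * x := by
  have hb := quarterGrowth_invSqCentral
  have h1 := ((hb.eulerCoeff.eulerCoeff.hasSum hx).mul_left 16).sub
    ((hb.eulerCoeff.hasSum hx).mul_left 8)
  have h2 := (hb.eulerCoeff.eulerCoeff.hasSum hx).mul_left 4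
  -- The defect is `(16 - 8) / binom(2, 1) = 4`.
  have := eq_of_hasSum_shift (δ := 4)
    (a := fun n => 16 * eulerCoeff (eulerCoeff invSqCentral) n - 8 * eulerCoeff invSqCentral n)
    (e := fun n => 4 * eulerCoeff (eulerCoeff invSqCentral) n)
    (h1.congr_fun fun n => by ring) (h2.congr_fun fun n => by ring) (by simp [eulerCoeff])
    (by norm_num [eulerCoeff, invSqCentral]) fun n hn => by
      have := invSqCentral_succ hn
      simp only [eulerCoeff]
      push_cast
      linear_combination this
  linear_combination this

theorem powSum_sunCoeff_ode {x : ℝ} (hx : |x| < 4) :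
    16 * powSum (eulerCoeff (eulerCoeff sunCoeff)) x - 8 * powSum (eulerCoeff sunCoeff) x
      - 4 * x * powSum (eulerCoeff (eulerCoeff sunCoeff)) x
      = (16 - 4 * x) * powSum (eulerCoeff invSqCentral) x - 4 * powSum invSqCentral x := by
  have hb := quarterGrowth_invSqCentral
  have hs := quarterGrowth_sunCoeff
  have h1 := ((((hs.eulerCoeff.eulerCoeff.hasSum hx).mul_left 16).sub
    ((hs.eulerCoeff.hasSum hx).mul_left 8)).sub ((hb.eulerCoeff.hasSum hx).mul_left 16)).add
    ((hb.hasSum hx).mul_left 4)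
  have h2 := ((hs.eulerCoeff.eulerCoeff.hasSum hx).mul_left 4).sub
    ((hb.eulerCoeff.hasSum hx).mul_left 4)
  have := eq_of_hasSum_shift (δ := 0)
    (a := fun n => 16 * eulerCoeff (eulerCoeff sunCoeff) n - 8 * eulerCoeff sunCoeff n
      - 16 * eulerCoeff invSqCentral n + 4 * invSqCentral n)
    (e := fun n => 4 * eulerCoeff (eulerCoeff sunCoeff) n - 4 * eulerCoeff invSqCentral n)
    (h1.congr_fun fun n => by ring) (h2.congr_fun fun n => by ring)
    (by simp [eulerCoeff, invSqCentral])
    (by norm_num [eulerCoeff, invSqCentral, sunCoeff, harmonicGap, harmonic,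
      Finset.sum_range_succ]) fun n hn => by
      have h3 := invSqCentral_succ hn
      have h4 := harmonicGap_succ hn
      have hn' : (n : ℝ) ≠ 0 := by exact_mod_cast hn
      simp only [eulerCoeff, sunCoeff]
      rw [h4]
      -- The increments of the gap cancel the denominators of the recurrence, leaving the polynomial
      -- factors of the source term.
      have h5 : (16 * ((n : ℝ) + 1) ^ 2 - 8 * (n + 1)) *
          (1 / (2 * (n : ℝ) + 1) + 1 / (2 * (n + 1))) = 16 * (n + 1) - 4 := by
        field_simp
        ring
      have h6 : 4 * (n : ℝ) ^ 2 * (1 / n) = 4 * n := by field_simp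
      push_cast
      linear_combination (harmonicGap n - 1 / n) * h3 + invSqCentral (n + 1) * h5
        - invSqCentral n * h6
  linear_combination this

/-- By `powSum_invSqCentral_ode` the second derivative in `θ` is `4x / x = 4`. This is the classical
series for `arcsin²`. -/
theorem powSum_invSqCentral_sin {θ : ℝ} (h : θ ∈ Set.Ioo 0 (Real.pi / 2)) :
    powSum invSqCentral (4 * Real.sin θ ^ 2) = 2 * θ ^ 2 ∧
      2 * (Real.cos θ / Real.sin θ) * powSum (eulerCoeff invSqCentral) (4 * Real.sin θ ^ 2)
        = 4 * θ := by
  have hb := quarterGrowth_invSqCentral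
  have hc : ∀ {f : ℝ → ℝ}, Continuous f → f 0 = 0 → Tendsto f (𝓝[>] 0) (𝓝 0) := fun hf h0 => by
    simpa [h0] using (hf.tendsto 0).mono_left nhdsWithin_le_nhds
  refine eq_of_second_deriv_eq (d := fun _ => 4) (g := fun t => 2 * t ^ 2) (g' := fun t => 4 * t)
    (fun t ht => hasDerivAt_powSum_sin hb ht)
    (fun t ht => (hasDerivAt_deriv_powSum_sin hb ht).congr_deriv ?_)
    (fun t _ => ((hasDerivAt_pow 2 t).const_mul 2).congr_deriv (by norm_num; ring))
    (fun t _ => ((hasDerivAt_id t).const_mul 4).congr_deriv (by norm_num))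
    (tendsto_powSum_sin_zero hb invSqCentral_zero) (tendsto_deriv_powSum_sin_zero hb)
    (hc (by fun_prop) (by simp)) (hc (by fun_prop) (by simp)) θ h
  have hs := Real.sin_pos_of_pos_of_lt_pi ht.1 (by linarith [ht.2, Real.pi_pos])
  rw [powSum_invSqCentral_ode (four_mul_sin_sq_lt ht)]
  field_simp

/-- Insert `B = 2θ²` and `DB = 2θ tan θ` into the source term, with `16 - 4x = 16 cos² θ`. -/
theorem hasDerivAt_deriv_powSum_sunCoeff_sin {θ : ℝ} (h : θ ∈ Set.Ioo 0 (Real.pi / 2)) :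
    HasDerivAt (fun t => 2 * (Real.cos t / Real.sin t) *
        powSum (eulerCoeff sunCoeff) (4 * Real.sin t ^ 2))
      (8 * θ * (Real.cos θ / Real.sin θ) - 2 * θ ^ 2 / Real.sin θ ^ 2) θ := by
  have hs := Real.sin_pos_of_pos_of_lt_pi h.1 (by linarith [h.2, Real.pi_pos])
  refine (hasDerivAt_deriv_powSum_sin quarterGrowth_sunCoeff h).congr_deriv ?_
  obtain ⟨h1, h2⟩ := powSum_invSqCentral_sin h
  rw [powSum_sunCoeff_ode (four_mul_sin_sq_lt h), h1]
  generalize powSum (eulerCoeff invSqCentral) (4 * Real.sin θ ^ 2) = p at h2 ⊢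
  field_simp at h2 ⊢
  have : Real.cos θ ^ 2 = 1 - Real.sin θ ^ 2 := Real.cos_sq' θ
  linear_combination 8 * Real.cos θ * h2 - 16 * p * this

/-! ### Clausen functions and their derivatives -/

/-- The Clausen function `∑ sin(nt) / n²`. -/
noncomputable def clausenSin (t : ℝ) : ℝ := ∑' n : ℕ, Real.sin (n * t) / (n : ℝ) ^ 2

/-- The Clausen-type function `∑ cos(nt) / n³`. -/
noncomputable def clausenCos (t : ℝ) : ℝ := ∑' n : ℕ, Real.cos (n * t) / (n : ℝ) ^ 3

theorem summable_one_div_sq : Summable fun n : ℕ => 1 / (n : ℝ) ^ 2 :=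
  Real.summable_one_div_nat_pow.2 (by norm_num)

theorem summable_clausenCos (t : ℝ) : Summable fun n : ℕ => Real.cos (n * t) / (n : ℝ) ^ 3 := by
  refine Summable.of_norm_bounded (Real.summable_one_div_nat_pow.2 (by norm_num : 1 < 3))
    fun n => ?_
  rw [norm_div, Real.norm_eq_abs, norm_pow, Real.norm_natCast]
  gcongr
  exact Real.abs_cos_le_one _

theorem norm_sin_div_sq_le (n : ℕ) (t : ℝ) :
    ‖Real.sin (n * t) / (n : ℝ) ^ 2‖ ≤ 1 / (n : ℝ) ^ 2 := by
  rw [norm_div, Real.norm_eq_abs, norm_pow, Real.norm_natCast]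
  gcongr
  exact Real.abs_sin_le_one _

theorem continuous_clausenSin : Continuous clausenSin :=
  continuous_tsum (fun n => by fun_prop) summable_one_div_sq norm_sin_div_sq_le

theorem hasDerivAt_clausenCos (t : ℝ) : HasDerivAt clausenCos (-clausenSin t) t := by
  rw [clausenSin, ← tsum_neg]
  refine hasDerivAt_tsum summable_one_div_sq (fun n y => ?_)
    (fun n y => (norm_neg _).trans_le (norm_sin_div_sq_le n y)) (summable_clausenCos 0) t
  refine ((((hasDerivAt_id y).const_mul (n : ℝ)).cos).div_const _).congr_deriv ?_
  rcases eq_or_ne n 0 with rfl | hn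
  · simp
  · have : (n : ℝ) ≠ 0 := by exact_mod_cast hn
    simp only [id]
    field_simp

/-- Real part of the Taylor series of `-log(1 - z)` at `z = r e^{it}`. -/
theorem hasSum_pow_mul_cos_div {r : ℝ} (hr0 : 0 ≤ r) (hr : r < 1) (t : ℝ) :
    HasSum (fun n : ℕ => r ^ n * Real.cos (n * t) / n)
      (-Real.log ‖1 - (r : ℂ) * Complex.exp (t * Complex.I)‖) := by
  have hz : ‖(r : ℂ) * Complex.exp (t * Complex.I)‖ < 1 := by
    rw [norm_mul, Complex.norm_exp_ofReal_mul_I, mul_one, Complex.norm_real,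
      Real.norm_of_nonneg hr0]
    exact hr
  have h := Complex.hasSum_re (Complex.hasSum_taylorSeries_neg_log hz)
  rw [Complex.neg_re, Complex.log_re] at h
  refine h.congr_fun fun n => ?_
  rw [mul_pow, ← Complex.exp_nat_mul, ← mul_assoc, ← Complex.ofReal_natCast n,
    ← Complex.ofReal_mul, ← Complex.ofReal_pow, Complex.div_ofReal_re, Complex.re_ofReal_mul,
    Complex.exp_ofReal_mul_I_re]

theorem hasDerivAt_tsum_pow_mul_sin {r : ℝ} (hr0 : 0 ≤ r) (hr : r < 1) (t : ℝ) :
    HasDerivAt (fun t => ∑' n : ℕ, r ^ n * Real.sin (n * t) / (n : ℝ) ^ 2)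
      (-Real.log ‖1 - (r : ℂ) * Complex.exp (t * Complex.I)‖) t := by
  rw [← (hasSum_pow_mul_cos_div hr0 hr t).tsum_eq]
  refine hasDerivAt_tsum (u := fun n => r ^ n) (y₀ := 0)
    (g := fun (n : ℕ) t => r ^ n * Real.sin (n * t) / (n : ℝ) ^ 2)
    (g' := fun (n : ℕ) t => r ^ n * Real.cos (n * t) / n) (summable_geometric_of_lt_one hr0 hr)
    (fun n y => ?_) (fun n y => ?_) (by simp) t
  · refine ((((hasDerivAt_id y).const_mul (n : ℝ)).sin.const_mul (r ^ n)).div_const _).congr_deriv ?_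
    rcases eq_or_ne n 0 with rfl | hn
    · simp
    · have : (n : ℝ) ≠ 0 := by exact_mod_cast hn
      simp only [id]
      field_simp
  · rcases eq_or_ne n 0 with rfl | hn
    · simp
    · have hn1 : (1 : ℝ) ≤ n := by exact_mod_cast Nat.one_le_iff_ne_zero.2 hn
      rw [norm_div, norm_mul, Real.norm_of_nonneg (pow_nonneg hr0 n), Real.norm_natCast]
      refine div_le_of_le_mul₀ (by positivity) (by positivity) ?_
      gcongr
      exact (Real.abs_cos_le_one _).trans hn1

theorem norm_one_sub_exp {t : ℝ} (h : 0 ≤ Real.sin (t / 2)) :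
    ‖1 - Complex.exp (t * Complex.I)‖ = 2 * Real.sin (t / 2) := by
  have := Complex.norm_exp_I_mul_ofReal_sub_one t
  rw [norm_sub_rev, mul_comm (t : ℂ), this, Real.norm_of_nonneg (by positivity)]

/-- Termwise differentiation gives only a conditionally convergent series, so the sum is regularised
by `rⁿ` and `r → 1⁻` is taken. The derivatives `-log|1 - r e^{iy}|` converge uniformly near `t`
because this function is jointly continuous at `(1, t)`: `sin(t/2) > 0` keeps `e^{it}` away from 1.
-/
theorem hasDerivAt_clausenSin {t : ℝ} (h : 0 < Real.sin (t / 2)) :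
    HasDerivAt clausenSin (-Real.log (2 * Real.sin (t / 2))) t := by
  rw [← norm_one_sub_exp h.le]
  set g : ℝ × ℝ → ℝ := fun p => -Real.log ‖1 - (p.1 : ℂ) * Complex.exp (p.2 * Complex.I)‖
  have hne : ‖1 - ((1 : ℝ) : ℂ) * Complex.exp (t * Complex.I)‖ ≠ 0 := by
    rw [Complex.ofReal_one, one_mul, norm_one_sub_exp h.le]
    positivity
  have hg : ContinuousAt g (1, t) := by
    have : ContinuousAt (fun p : ℝ × ℝ => ‖1 - (p.1 : ℂ) * Complex.exp (p.2 * Complex.I)‖) (1, t) := by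
      fun_prop
    exact (this.log hne).neg
  have hmem : ∀ᶠ r : ℝ in 𝓝[<] 1, 0 ≤ r ∧ r < 1 := by
    filter_upwards [Ioo_mem_nhdsLT (zero_lt_one (α := ℝ))] with r hr using ⟨hr.1.le, hr.2⟩
  have key := hasDerivAt_of_tendstoUniformlyOnFilter (l := 𝓝[<] (1 : ℝ)) (x := t)
    (f := fun r t => ∑' n : ℕ, r ^ n * Real.sin (n * t) / (n : ℝ) ^ 2)
    (f' := fun r t => g (r, t)) (g := clausenSin) (g' := fun t => g (1, t)) ?_ ?_ ?_
  · simpa [g] using key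
  · rw [Metric.tendstoUniformlyOnFilter_iff]
    intro ε hε
    have h1 := Metric.continuousAt_iff'.1 hg (ε / 2) (half_pos hε)
    rw [nhds_prod_eq] at h1
    have h2 : ∀ᶠ p : ℝ × ℝ in 𝓝[<] 1 ×ˢ 𝓝 t, dist (g p) (g (1, t)) < ε / 2 :=
      h1.filter_mono (Filter.prod_mono nhdsWithin_le_nhds le_rfl)
    have h3 : ∀ᶠ y in 𝓝 t, dist (g (1, y)) (g (1, t)) < ε / 2 := by
      have : ContinuousAt (fun y => g (1, y)) t :=
        ContinuousAt.comp (f := fun y : ℝ => ((1 : ℝ), y)) hg (by fun_prop)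
      exact Metric.continuousAt_iff'.1 this (ε / 2) (half_pos hε)
    filter_upwards [h2, tendsto_snd.eventually h3] with p hp hp'
    have := dist_triangle_right (g (1, p.2)) (g p) (g (1, t))
    linarith
  · filter_upwards [tendsto_fst.eventually hmem] with p hp using
      hasDerivAt_tsum_pow_mul_sin hp.1 hp.2 p.2
  · refine Eventually.of_forall fun y => ?_
    refine tendsto_tsum_of_dominated_convergence summable_one_div_sq (fun n => ?_) ?_
    · have : ContinuousAt (fun r : ℝ => r ^ n * Real.sin (n * y) / (n : ℝ) ^ 2) 1 := by fun_prop
      simpa using this.tendsto.mono_left nhdsWithin_le_nhds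
    · filter_upwards [hmem] with r hr n
      rw [mul_div_assoc, norm_mul, norm_pow, Real.norm_of_nonneg hr.1]
      exact (mul_le_of_le_one_left (norm_nonneg _) (pow_le_one₀ hr.1 hr.2.le)).trans
        (norm_sin_div_sq_le n y)

/-! ### The closed form of the generating series -/

theorem tendsto_div_sin_zero : Tendsto (fun t => t / Real.sin t) (𝓝[>] 0) (𝓝 1) := by
  have h := (Real.continuous_sinc.tendsto 0).mono_left (nhdsWithin_le_nhds (s := Set.Ioi 0))
  rw [Real.sinc_zero] at h
  have h' := h.inv₀ one_ne_zero
  rw [inv_one] at h'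
  refine h'.congr' ?_
  filter_upwards [self_mem_nhdsWithin] with t ht
  rw [Real.sinc_of_ne_zero (ne_of_gt ht), inv_div]

theorem tendsto_mul_log_sin_zero :
    Tendsto (fun t => t * Real.log (2 * Real.sin t)) (𝓝[>] 0) (𝓝 0) := by
  have h1 : Continuous fun t => 2 * Real.sin t * Real.log (2 * Real.sin t) :=
    Real.continuous_mul_log.comp (by fun_prop)
  have h2 := (h1.tendsto 0).mono_left (nhdsWithin_le_nhds (s := Set.Ioi 0))
  -- Write `t log(2 sin t)` as `(t / sin t) / 2` times `u log u` with `u = 2 sin t`.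
  have h3 := (tendsto_div_sin_zero.div_const 2).mul h2
  simp only [Real.sin_zero, mul_zero, zero_mul] at h3
  refine h3.congr' ?_
  filter_upwards [Ioo_mem_nhdsGT Real.pi_pos] with t ht
  have := Real.sin_pos_of_mem_Ioo ht
  field_simp

theorem powSum_sunCoeff_sin {θ : ℝ} (h : θ ∈ Set.Ioo 0 (Real.pi / 2)) :
    powSum sunCoeff (4 * Real.sin θ ^ 2)
      = clausenCos 0 - clausenCos (2 * θ) + 2 * θ ^ 2 * Real.log (2 * Real.sin θ) := by
  have hs := quarterGrowth_sunCoeff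
  have hsin : ∀ t ∈ Set.Ioo 0 (Real.pi / 2), 0 < Real.sin t := fun t ht =>
    Real.sin_pos_of_pos_of_lt_pi ht.1 (by linarith [ht.2, Real.pi_pos])
  have hlog : ∀ t ∈ Set.Ioo 0 (Real.pi / 2), HasDerivAt (fun t => Real.log (2 * Real.sin t))
      (Real.cos t / Real.sin t) t := fun t ht => by
    have := hsin t ht
    refine (((Real.hasDerivAt_sin t).const_mul 2).log (by positivity)).congr_deriv ?_
    field_simp
  have h2 : ∀ t : ℝ, HasDerivAt (fun t => 2 * t) 2 t := fun t =>
    ((hasDerivAt_id t).const_mul 2).congr_deriv (by norm_num)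
  have hid : Tendsto (fun t : ℝ => t) (𝓝[>] 0) (𝓝 0) := tendsto_id.mono_left nhdsWithin_le_nhds
  refine (eq_of_second_deriv_eq
    (g := fun t => clausenCos 0 - clausenCos (2 * t) + 2 * t ^ 2 * Real.log (2 * Real.sin t))
    (g' := fun t => 2 * clausenSin (2 * t) + 4 * t * Real.log (2 * Real.sin t)
      + 2 * t ^ 2 * (Real.cos t / Real.sin t))
    (fun t ht => hasDerivAt_powSum_sin hs ht)
    (fun t ht => hasDerivAt_deriv_powSum_sunCoeff_sin ht) (fun t ht => ?_) (fun t ht => ?_)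
    (tendsto_powSum_sin_zero hs (by simp [sunCoeff, invSqCentral_zero]))
    (tendsto_deriv_powSum_sin_zero hs) ?_ ?_ θ h).1
  · have h3 := (hasDerivAt_clausenCos (2 * t)).comp t (h2 t)
    refine ((h3.const_sub (clausenCos 0)).add
      (((hasDerivAt_pow 2 t).const_mul 2).mul (hlog t ht))).congr_deriv ?_
    push_cast
    ring
  · have hst := hsin t ht
    have h3 := (hasDerivAt_clausenSin (t := 2 * t) (by
      rwa [mul_div_cancel_left₀ t two_ne_zero])).comp t (h2 t)
    rw [mul_div_cancel_left₀ t two_ne_zero] at h3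
    have h4 := ((hasDerivAt_pow 2 t).const_mul 2).mul
      ((Real.hasDerivAt_cos t).div (Real.hasDerivAt_sin t) hst.ne')
    refine (((h3.const_mul 2).add (((hasDerivAt_id t).const_mul 4).mul (hlog t ht))).add
      h4).congr_deriv ?_
    have h5 : Real.cos t ^ 2 = 1 - Real.sin t ^ 2 := Real.cos_sq' t
    simp only [id, Pi.div_apply]
    push_cast
    field_simp
    ring_nf
    rw [h5]
    ring
  · have h3 : Continuous clausenCos :=
      continuous_iff_continuousAt.2 fun t => (hasDerivAt_clausenCos t).continuousAt
    have h4 : Continuous fun t => clausenCos 0 - clausenCos (2 * t) := by fun_prop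
    have h5 := (h4.tendsto 0).mono_left (nhdsWithin_le_nhds (s := Set.Ioi 0))
    have h6 := h5.add ((hid.const_mul 2).mul tendsto_mul_log_sin_zero)
    simp only [mul_zero, sub_self, add_zero] at h6
    exact h6.congr fun t => by ring
  · have h3 : Continuous fun t => 2 * clausenSin (2 * t) := by
      have := continuous_clausenSin
      fun_prop
    have h4 := (h3.tendsto 0).mono_left (nhdsWithin_le_nhds (s := Set.Ioi 0))
    have h5 := (Real.continuous_cos.tendsto 0).mono_left (nhdsWithin_le_nhds (s := Set.Ioi 0))
    have h6 := (h4.add (tendsto_mul_log_sin_zero.const_mul 4)).add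
      (((hid.const_mul 2).mul tendsto_div_sin_zero).mul h5)
    have h7 : clausenSin 0 = 0 := by simp [clausenSin]
    simp only [mul_zero, zero_mul, add_zero, h7] at h6
    exact h6.congr fun t => by ring

/-! ### The distribution relation and special values -/

/-- Real part of a geometric sum over powers of an `m`-th root of unity. -/
theorem sum_cos_nat_mul_add {m : ℕ} (hm : m ≠ 0) (n : ℕ) (t : ℝ) :
    ∑ k ∈ Finset.range m, Real.cos (n * (t + 2 * Real.pi * k / m))
      = if m ∣ n then m * Real.cos (n * t) else 0 := by
  have hζ := Complex.isPrimitiveRoot_exp m hm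
  set ζ := Complex.exp (2 * Real.pi * Complex.I / m) with hζ'
  have key : ∀ k : ℕ, Real.cos (n * (t + 2 * Real.pi * k / m))
      = (Complex.exp ((n * t : ℝ) * Complex.I) * (ζ ^ n) ^ k).re := fun k => by
    rw [← Complex.exp_ofReal_mul_I_re, hζ', ← pow_mul, ← Complex.exp_nat_mul, ← Complex.exp_add]
    congr 2
    push_cast
    ring
  simp_rw [key, ← Complex.re_sum, ← Finset.mul_sum]
  split_ifs with h
  · have : ζ ^ n = 1 := (hζ.pow_eq_one_iff_dvd n).2 h
    simp only [this, one_pow, Finset.sum_const, Finset.card_range, nsmul_eq_mul, mul_one]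
    rw [mul_comm, ← Complex.ofReal_natCast, Complex.re_ofReal_mul, Complex.exp_ofReal_mul_I_re]
  · have : ζ ^ n ≠ 1 := fun h' => h ((hζ.pow_eq_one_iff_dvd n).1 h')
    rw [geom_sum_eq this, ← pow_mul, mul_comm n, pow_mul, hζ.pow_eq_one]
    simp

theorem sum_clausenCos_add {m : ℕ} (hm : m ≠ 0) (t : ℝ) :
    ∑ k ∈ Finset.range m, clausenCos (t + 2 * Real.pi * k / m) = clausenCos (m * t) / m ^ 2 := by
  have hm' : (m : ℝ) ≠ 0 := by exact_mod_cast hm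
  simp_rw [clausenCos]
  rw [← Summable.tsum_finsetSum fun k _ => summable_clausenCos _, ← tsum_div_const]
  simp_rw [← Finset.sum_div, sum_cos_nat_mul_add hm]
  have hinj : Function.Injective fun k : ℕ => m * k := mul_right_injective₀ hm
  rw [← hinj.tsum_eq]
  · refine tsum_congr fun n => ?_
    rw [if_pos (dvd_mul_right m n)]
    push_cast
    rw [show (m : ℝ) * n * t = n * (m * t) by ring]
    rcases eq_or_ne n 0 with rfl | hn
    · simp
    · have : (n : ℝ) ≠ 0 := by exact_mod_cast hn
      field_simp
  · intro n hn
    by_contra h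
    refine hn ?_
    beta_reduce
    rw [if_neg fun ⟨k, hk⟩ => h ⟨k, hk.symm⟩, zero_div]

theorem clausenCos_two_pi_sub (t : ℝ) : clausenCos (2 * Real.pi - t) = clausenCos t := by
  refine tsum_congr fun n => ?_
  rw [mul_sub, Real.cos_nat_mul_two_pi_sub]

theorem clausenCos_add_pi (t : ℝ) :
    clausenCos t + clausenCos (t + Real.pi) = clausenCos (2 * t) / 4 := by
  have := sum_clausenCos_add two_ne_zero t
  norm_num [Finset.sum_range_succ] at this
  exact this

theorem clausenCos_fifths : clausenCos (2 * Real.pi / 5) + clausenCos (4 * Real.pi / 5)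
    = -12 / 25 * clausenCos 0 := by
  have h := sum_clausenCos_add (m := 5) (by norm_num) 0
  have h3 := clausenCos_two_pi_sub (4 * Real.pi / 5)
  have h4 := clausenCos_two_pi_sub (2 * Real.pi / 5)
  simp only [Finset.sum_range_succ, Finset.sum_range_zero] at h
  norm_num at h
  rw [show 2 * Real.pi - 4 * Real.pi / 5 = 2 * Real.pi * 3 / 5 by ring] at h3
  rw [show 2 * Real.pi - 2 * Real.pi / 5 = 2 * Real.pi * 4 / 5 by ring] at h4
  rw [h3, h4, show 2 * Real.pi * 2 / 5 = 4 * Real.pi / 5 by ring] at h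
  linarith

/-- Adding the duplication formulas at `π/5` and `3π/5` gives odd sum + even sum = even sum / 4, so
the factor is `(-3/4)(-12/25)`. -/
theorem clausenCos_odd_fifths : clausenCos (3 * Real.pi / 5) + clausenCos (Real.pi / 5)
    = 9 / 25 * clausenCos 0 := by
  have h1 := clausenCos_add_pi (Real.pi / 5)
  have h2 := clausenCos_add_pi (3 * Real.pi / 5)
  have h3 := clausenCos_two_pi_sub (4 * Real.pi / 5)
  have h4 := clausenCos_two_pi_sub (2 * Real.pi / 5)
  have h5 := clausenCos_fifths
  ring_nf at *
  linarith

/-- Duplication reduces the sum to `Cl(π/3) / 4`; duplication and triplication give `Cl(2π/3) = -4/9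
Cl(0)` and `Cl(π/3) = 1/3 Cl(0)`. -/
theorem clausenCos_sixths : clausenCos (5 * Real.pi / 6) + clausenCos (Real.pi / 6)
    = 1 / 12 * clausenCos 0 := by
  have h1 := clausenCos_add_pi (Real.pi / 6)
  have h2 := clausenCos_add_pi (Real.pi / 3)
  have h3 := sum_clausenCos_add (m := 3) (by norm_num) 0
  have h4 := clausenCos_two_pi_sub (5 * Real.pi / 6)
  have h5 := clausenCos_two_pi_sub (2 * Real.pi / 3)
  simp only [Finset.sum_range_succ, Finset.sum_range_zero] at h3
  norm_num at h3
  ring_nf at *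
  linarith

/-- Repeated duplication: `Cl(π) = -3/4 Cl(0)`, `Cl(π/2) = -3/32 Cl(0)`, and the sum is `Cl(π/2) /
4`. -/
theorem clausenCos_fourths : clausenCos (3 * Real.pi / 4) + clausenCos (Real.pi / 4)
    = -3 / 128 * clausenCos 0 := by
  have h1 := clausenCos_add_pi (Real.pi / 4)
  have h2 := clausenCos_add_pi (Real.pi / 2)
  have h3 := clausenCos_add_pi 0
  have h4 := clausenCos_two_pi_sub (3 * Real.pi / 4)
  have h5 := clausenCos_two_pi_sub (Real.pi / 2)
  ring_nf at *
  linarith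

theorem riemannZeta_three : riemannZeta 3 = (clausenCos 0 : ℂ) := by
  have := zeta_nat_eq_tsum_of_gt_one (k := 3) (by norm_num)
  rw [clausenCos, Complex.ofReal_tsum]
  simpa using this

/-! ### Lucas sequences and the four evaluations -/

theorem lucasV_eq_pow_add_pow {A B : ℤ} {x y : ℝ} (hA : x + y = A) (hB : x * y = B) (n : ℕ) :
    (lucasV A B n : ℝ) = x ^ n + y ^ n := by
  induction n using lucasV.induct with
  | case1 => norm_num [lucasV]
  | case2 => simp [lucasV, hA]
  | case3 n ih1 ih2 =>
    rw [lucasV]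
    push_cast
    rw [ih1, ih2, ← hA, ← hB]
    change _ = x ^ (n + 2) + y ^ (n + 2)
    ring

theorem four_mul_sin_sq (θ : ℝ) : 4 * Real.sin θ ^ 2 = 2 - 2 * Real.cos (2 * θ) := by
  rw [Real.sin_sq_eq_half_sub]
  ring

theorem powSum_sunCoeff_of_cos {θ x : ℝ} (h : θ ∈ Set.Ioo 0 (Real.pi / 2))
    (hx : 2 - 2 * Real.cos (2 * θ) = x) :
    HasSum (fun n => sunCoeff n * x ^ n)
      (clausenCos 0 - clausenCos (2 * θ) + θ ^ 2 * Real.log x) := by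
  rw [← four_mul_sin_sq] at hx
  subst hx
  have hs := Real.sin_pos_of_pos_of_lt_pi h.1 (by linarith [h.2, Real.pi_pos])
  have h1 : Real.log (4 * Real.sin θ ^ 2) = 2 * Real.log (2 * Real.sin θ) := by
    rw [show 4 * Real.sin θ ^ 2 = (2 * Real.sin θ) ^ 2 by ring, Real.log_pow]
    norm_num
  have h2 := quarterGrowth_sunCoeff.hasSum (four_mul_sin_sq_lt h)
  rw [powSum_sunCoeff_sin h] at h2
  rw [h1]
  convert! h2 using 1
  ring

theorem hasSum_sunTerm {A B : ℤ} {θ η x y : ℝ} (hθ : θ ∈ Set.Ioo 0 (Real.pi / 2))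
    (hη : η ∈ Set.Ioo 0 (Real.pi / 2)) (hx : 2 - 2 * Real.cos (2 * θ) = x)
    (hy : 2 - 2 * Real.cos (2 * η) = y) (hA : x + y = A) (hB : x * y = B) :
    HasSum (fun n : ℕ+ => sunTerm (lucasV A B) (n : ℕ))
      ((2 * clausenCos 0 - (clausenCos (2 * θ) + clausenCos (2 * η)) + θ ^ 2 * Real.log x
        + η ^ 2 * Real.log y : ℝ) : ℂ) := by
  have h := (powSum_sunCoeff_of_cos hθ hx).add (powSum_sunCoeff_of_cos hη hy)
  have h' : HasSum (sunTerm (lucasV A B)) ((2 * clausenCos 0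
      - (clausenCos (2 * θ) + clausenCos (2 * η)) + θ ^ 2 * Real.log x
        + η ^ 2 * Real.log y : ℝ) : ℂ) := by
    convert! Complex.hasSum_ofReal.2 h using 1
    · funext n
      have : (lucasV A B n : ℂ) = ((x ^ n + y ^ n : ℝ) : ℂ) := by
        rw [← lucasV_eq_pow_add_pow hA hB]
        simp
      rw [sunTerm, this, ← mul_add, sunCoeff, invSqCentral, harmonicGap]
      push_cast
      ring
    · congr 1
      ring
  -- The index 0 contributes nothing, since division by zero yields 0.
  refine (PNat.coe_injective.hasSum_iff fun n hn => ?_).2 h'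
  have : n = 0 := by
    by_contra h0
    exact hn ⟨⟨n, Nat.pos_of_ne_zero h0⟩, rfl⟩
  simp [this, sunTerm]

theorem lucasV_three_one (n : ℕ) : lucasV 3 1 n = lucasNumber (2 * n) := by
  induction n using lucasV.induct with
  | case1 => rfl
  | case2 => rfl
  | case3 n ih1 ih2 =>
    have h1 : lucasNumber (2 * (n + 2)) = lucasNumber (2 * n + 3) + lucasNumber (2 * (n + 1)) := rfl
    have h2 : lucasNumber (2 * n + 3) = lucasNumber (2 * (n + 1)) + lucasNumber (2 * n + 1) := rfl
    have h3 : lucasNumber (2 * (n + 1)) = lucasNumber (2 * n + 1) + lucasNumber (2 * n) := rfl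
    rw [lucasV, ih1, ih2]
    linarith

theorem cos_two_pi_div_five : Real.cos (2 * Real.pi / 5) = (√5 - 1) / 4 := by
  have h5 : √5 ^ 2 = (5 : ℝ) := Real.sq_sqrt (by norm_num)
  rw [mul_div_assoc, Real.cos_two_mul, Real.cos_pi_div_five]
  linarith

theorem cos_three_pi_div_five : Real.cos (3 * Real.pi / 5) = -(√5 - 1) / 4 := by
  rw [show 3 * Real.pi / 5 = Real.pi - 2 * Real.pi / 5 by ring, Real.cos_pi_sub,
    cos_two_pi_div_five]
  ring

theorem cos_four_pi_div_five : Real.cos (4 * Real.pi / 5) = -(1 + √5) / 4 := by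
  rw [show 4 * Real.pi / 5 = Real.pi - Real.pi / 5 by ring, Real.cos_pi_sub,
    Real.cos_pi_div_five]
  ring

theorem hasSum_sunTerm_lucasV_three_one :
    HasSum (fun n : ℕ+ => sunTerm (lucasV 3 1) (n : ℕ))
      ((41 * riemannZeta 3
        + 4 * (Real.pi : ℂ) ^ 2 * (Real.log Real.goldenRatio : ℂ)) / 25) := by
  have h5 : √5 ^ 2 = (5 : ℝ) := Real.sq_sqrt (by norm_num)
  have hπ := Real.pi_pos
  have hφ : Real.goldenRatio ≠ 0 := Real.goldenRatio_ne_zero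
  have h2 : 2 * (Real.pi / 10) = Real.pi / 5 := by ring
  have h6 : 2 * (3 * Real.pi / 10) = 3 * Real.pi / 5 := by ring
  -- The roots of `t² - 3t + 1` are `φ²` and `φ⁻²`. Their logarithms are opposite, so the `π²` part
  -- is `2 (9 - 1) / 100 = 4/25` times `log φ`.
  have h := hasSum_sunTerm (A := 3) (B := 1) (θ := 3 * Real.pi / 10) (η := Real.pi / 10)
    (x := Real.goldenRatio ^ 2) (y := (Real.goldenRatio ^ 2)⁻¹)
    ⟨by positivity, by linarith⟩ ⟨by positivity, by linarith⟩
    (by rw [h6, cos_three_pi_div_five, Real.goldenRatio]; linarith)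
    (by
      rw [h2, Real.cos_pi_div_five]
      refine eq_inv_of_mul_eq_one_left ?_
      rw [Real.goldenRatio]
      ring_nf
      rw [show √5 ^ 3 = √5 ^ 2 * √5 by ring, h5]
      ring)
    (by
      rw [← inv_pow, Real.inv_goldenRatio, Real.goldenRatio, Real.goldenConj]
      push_cast
      linarith)
    (by rw [mul_inv_cancel₀ (by positivity)]; simp)
  convert! h using 1
  rw [riemannZeta_three, h2, h6, clausenCos_odd_fifths, Real.log_inv, Real.log_pow]
  push_cast
  ring

theorem hasSum_sunTerm_lucasV_five_five :
    HasSum (fun n : ℕ+ => sunTerm (lucasV 5 5) (n : ℕ))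
      ((124 * riemannZeta 3
        + (Real.pi : ℂ) ^ 2 * (Real.log (5 ^ 5 * Real.goldenRatio ^ 6) : ℂ)) / 50) := by
  have h5 : √5 ^ 2 = (5 : ℝ) := Real.sq_sqrt (by norm_num)
  have h5' : √5 ≠ 0 := by positivity
  have hπ := Real.pi_pos
  have hφ : Real.goldenRatio ≠ 0 := Real.goldenRatio_ne_zero
  have h2 : 2 * (Real.pi / 5) = 2 * Real.pi / 5 := by ring
  have h6 : 2 * (2 * Real.pi / 5) = 4 * Real.pi / 5 := by ring
  -- The roots `(5 ± √5) / 2` are written as `√5 φ` and `√5 φ⁻¹` so that their logarithms split into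
  -- `log 5` and `log φ`.
  have h := hasSum_sunTerm (A := 5) (B := 5) (θ := 2 * Real.pi / 5) (η := Real.pi / 5)
    (x := √5 * Real.goldenRatio) (y := √5 * Real.goldenRatio⁻¹)
    ⟨by positivity, by linarith⟩ ⟨by positivity, by linarith⟩
    (by rw [h6, cos_four_pi_div_five, Real.goldenRatio]; linarith)
    (by
      rw [h2, cos_two_pi_div_five, Real.inv_goldenRatio, Real.goldenConj]
      linarith)
    (by
      rw [Real.inv_goldenRatio, Real.goldenRatio, Real.goldenConj]
      push_cast
      linarith)
    (by
      rw [mul_mul_mul_comm, mul_inv_cancel₀ hφ, mul_one, ← sq, h5]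
      simp)
  convert! h using 1
  rw [riemannZeta_three, h2, h6, add_comm (clausenCos _), clausenCos_fifths,
    Real.log_mul h5' hφ, Real.log_mul h5' (inv_ne_zero hφ), Real.log_inv,
    Real.log_mul (by norm_num) (pow_ne_zero 6 hφ), Real.log_pow, Real.log_pow,
    Real.log_sqrt (by norm_num)]
  push_cast
  ring

theorem hasSum_sunTerm_lucasV_four_one :
    HasSum (fun n : ℕ+ => sunTerm (lucasV 4 1) (n : ℕ))
      ((23 * riemannZeta 3
        + 2 * (Real.pi : ℂ) ^ 2 * (Real.log (2 + Real.sqrt 3) : ℂ)) / 12) := by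
  have h3 : √3 ^ 2 = (3 : ℝ) := Real.sq_sqrt (by norm_num)
  have hπ := Real.pi_pos
  have h2 : 2 * (Real.pi / 12) = Real.pi / 6 := by ring
  have h6 : 2 * (5 * Real.pi / 12) = 5 * Real.pi / 6 := by ring
  have hinv : (2 + √3)⁻¹ = 2 - √3 := inv_eq_of_mul_eq_one_left (by linear_combination -h3)
  have h := hasSum_sunTerm (A := 4) (B := 1) (θ := 5 * Real.pi / 12) (η := Real.pi / 12)
    (x := 2 + √3) (y := (2 + √3)⁻¹)
    ⟨by positivity, by linarith⟩ ⟨by positivity, by linarith⟩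
    (by
      rw [h6, show 5 * Real.pi / 6 = Real.pi - Real.pi / 6 by ring, Real.cos_pi_sub,
        Real.cos_pi_div_six]
      ring)
    (by rw [h2, Real.cos_pi_div_six, hinv]; ring)
    (by rw [hinv]; push_cast; ring)
    (by rw [mul_inv_cancel₀ (by positivity)]; simp)
  convert! h using 1
  rw [riemannZeta_three, h2, h6, clausenCos_sixths, Real.log_inv]
  push_cast
  ring

theorem hasSum_sunTerm_lucasV_four_two :
    HasSum (fun n : ℕ+ => sunTerm (lucasV 4 2) (n : ℕ))
      ((259 * riemannZeta 3
        + 2 * (Real.pi : ℂ) ^ 2 *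
          (5 * (Real.log 2 : ℂ) + 8 * (Real.log (1 + Real.sqrt 2) : ℂ))) / 128) := by
  have h3 : √2 ^ 2 = (2 : ℝ) := Real.sq_sqrt (by norm_num)
  have hs : √2 ≠ 0 := by positivity
  have hs' : 1 + √2 ≠ 0 := by positivity
  have hπ := Real.pi_pos
  have h2 : 2 * (Real.pi / 8) = Real.pi / 4 := by ring
  have h6 : 2 * (3 * Real.pi / 8) = 3 * Real.pi / 4 := by ring
  have hinv : (1 + √2)⁻¹ = √2 - 1 := inv_eq_of_mul_eq_one_left (by linear_combination h3)
  -- Likewise the roots `2 ± √2` factor as `√2 (1 + √2)` and `√2 (1 + √2)⁻¹`.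
  have h := hasSum_sunTerm (A := 4) (B := 2) (θ := 3 * Real.pi / 8) (η := Real.pi / 8)
    (x := √2 * (1 + √2)) (y := √2 * (1 + √2)⁻¹)
    ⟨by positivity, by linarith⟩ ⟨by positivity, by linarith⟩
    (by
      rw [h6, show 3 * Real.pi / 4 = Real.pi - Real.pi / 4 by ring, Real.cos_pi_sub,
        Real.cos_pi_div_four]
      linear_combination -h3)
    (by rw [h2, Real.cos_pi_div_four, hinv]; linear_combination -h3)
    (by rw [hinv]; push_cast; linear_combination 2 * h3)
    (by rw [mul_mul_mul_comm, mul_inv_cancel₀ hs', mul_one, ← sq, h3]; simp)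
  convert! h using 1
  rw [riemannZeta_three, h2, h6, clausenCos_fourths, Real.log_mul hs hs',
    Real.log_mul hs (inv_ne_zero hs'), Real.log_inv, Real.log_sqrt (by norm_num)]
  push_cast
  ring

theorem mainTheorem1 :
    (∀ n : ℕ, lucasV 3 1 n = lucasNumber (2 * n)) ∧
    HasSum (fun n : ℕ+ => sunTerm (fun k => lucasNumber (2 * k)) (n : ℕ))
      ((41 * riemannZeta 3
        + 4 * (Real.pi : ℂ) ^ 2 * (Real.log Real.goldenRatio : ℂ)) / 25) ∧
    HasSum (fun n : ℕ+ => sunTerm (lucasV 5 5) (n : ℕ))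
      ((124 * riemannZeta 3
        + (Real.pi : ℂ) ^ 2 * (Real.log (5 ^ 5 * Real.goldenRatio ^ 6) : ℂ)) / 50) ∧
    HasSum (fun n : ℕ+ => sunTerm (lucasV 4 1) (n : ℕ))
      ((23 * riemannZeta 3
        + 2 * (Real.pi : ℂ) ^ 2 * (Real.log (2 + Real.sqrt 3) : ℂ)) / 12) ∧
    HasSum (fun n : ℕ+ => sunTerm (lucasV 4 2) (n : ℕ))
      ((259 * riemannZeta 3
        + 2 * (Real.pi : ℂ) ^ 2 *
          (5 * (Real.log 2 : ℂ) + 8 * (Real.log (1 + Real.sqrt 2) : ℂ))) / 128) :=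
  ⟨lucasV_three_one,
    funext lucasV_three_one ▸ hasSum_sunTerm_lucasV_three_one,
    hasSum_sunTerm_lucasV_five_five, hasSum_sunTerm_lucasV_four_one,
    hasSum_sunTerm_lucasV_four_two⟩
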